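/- Let $r\ge 0$ and $n\ge r+2$ be integers, and let $a_1,\dots,a_r$ be distinct elements of $[n]=\{1,\dots,n\}$. Let $\pi$ be a uniformly random permutation of $[n]$ conditioned on $\pi(1)=a_1,\dots,\pi(r)=a_r$. Let $$\mathcal I=\{(i,k) : k\in\{-r+1,\dots,r-1\},\ i\in\{r+1,\dots,n\},\ i+k\in\{1,\dots,n\}\},$$ and for $(i,k)\in\mathcal I$ let $I(i,k)$ be the indicator of the event that position $i$ is $k$-separated in $\pi$, that is, that $\pi(i)=i+k$. Let $\mathbf I=(I(i,k))_{(i,k)\in\mathcal I}$, and let $\mathbf Z=(Z(i,k))_{(i,k)\in\mathcal I}$ be a vector of independent random variables, each with the Poisson distribution of mean $1/n$. Then $$d_{TV}(\mathbf I,\mathbf Z)\le\frac{16r^2+2r}{n-r-1},$$ where $d_{TV}(X,Y)=\sup_{S}|\mathbf P[X\in S]-\mathbf P[Y\in S]|$, the supremum being over all sets $S$ of possible values (here $S\subseteq\{0,1,2,\dots\}^{\mathcal I}$), is the total variation distance between the laws of $X$ and $Y$. -/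

import Mathlib

open MeasureTheory ProbabilityTheory
open scoped NNReal

/-- Total variation distance between the laws `P` and `Q` of two random variables with values in
`S`: the supremum over events `A ⊆ S` of `|P(A) - Q(A)|`. (On a countable space with measurable
singletons, such as `ι → ℕ` for finite `ι`, every subset is an event.) -/
noncomputable def tvDist {S : Type*} [MeasurableSpace S] (P Q : Measure S) : ℝ :=
  ⨆ A : {A : Set S // MeasurableSet A}, |P.real A.1 - Q.real A.1|

/-- The supremum defining `tvDist` is over a bounded family for probability measures. -/
theorem tvDist_bddAbove {S : Type*} [MeasurableSpace S] (P Q : Measure S)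
    [IsProbabilityMeasure P] [IsProbabilityMeasure Q] :
    BddAbove (Set.range fun A : {A : Set S // MeasurableSet A} => |P.real A.1 - Q.real A.1|) := by
  refine ⟨1, ?_⟩
  rintro _ ⟨A, rfl⟩
  have h1 : P.real A.1 ≤ 1 := measureReal_le_one
  have h2 : Q.real A.1 ≤ 1 := measureReal_le_one
  have h3 : 0 ≤ P.real A.1 := measureReal_nonneg
  have h4 : 0 ≤ Q.real A.1 := measureReal_nonneg
  exact abs_le.mpr ⟨by linarith, by linarith⟩

/-- The finite set of permutations carries the discrete sigma-algebra. -/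
instance permMeasurableSpace (n : ℕ) : MeasurableSpace (Equiv.Perm (Fin n)) := ⊤

/-- Position `i` is `k`-separated in `π` if `π(i) = i + k`. The set `[n] = {1, …, n}` is modelled
by `Fin n = {0, …, n - 1}`; the shift by one on both sides cancels. -/
def IsSeparated {n : ℕ} (π : Equiv.Perm (Fin n)) (i : Fin n) (k : ℤ) : Prop :=
  ((π i : ℕ) : ℤ) = ((i : ℕ) : ℤ) + k

/-- The pairs `(i, k)` with `-r + 1 ≤ k ≤ r - 1`, with `i` among the positions after the first `r`,
and with `i + k` again a position. In terms of `Fin n = {0, …, n - 1}`, where the `j`-th position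
is `j - 1`, the latter two read `r ≤ i` and `0 ≤ i + k < n`. -/
noncomputable def sepIndex (n r : ℕ) : Finset (Fin n × ℤ) :=
  (Finset.univ ×ˢ Finset.Icc (-(r : ℤ) + 1) ((r : ℤ) - 1)).filter fun p =>
    r ≤ (p.1 : ℕ) ∧ 0 ≤ ((p.1 : ℕ) : ℤ) + p.2 ∧ ((p.1 : ℕ) : ℤ) + p.2 < (n : ℤ)

open Classical in
/-- The vector `(I(i, k))` of indicators of `i` being `k`-separated in `π`, over all `(i, k)` in
`sepIndex n r`. -/
noncomputable def sepIndicators (n r : ℕ) (π : Equiv.Perm (Fin n)) : sepIndex n r → ℕ :=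
  fun p => if IsSeparated π p.1.1 p.1.2 then 1 else 0

/-! ### Poisson approximation in a commutative Banach algebra -/

section BanachAlgebra

variable {𝔸 : Type*} [NormedCommRing 𝔸]

/-! The argument combines a size-bias coupling with an interpolation of generating functions. Let `e
a` be commuting contractions. A finite sum over configurations `x` of the products of `e a` over `a
∈ I x` is joined to the Poisson element `exp (∑ a, l a • (e a - 1))`, scaled by the number of
configurations, by thinning the configurations with parameter `s` while adding independent Poisson
points with parameter `1 - s`. The derivative in `s` compares, for each `a`, a configuration
modified so as to contain `a`, with `a` then removed, to the original one. It is therefore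
controlled by `|p a - l a|` and by the number of other indices the modification disturbs
(`norm_sum_prod_sub_smul_exp_le`).

Taking for `e a` the shift operators on bounded functions of count vectors turns generating elements
into laws: a product of shifts evaluates a function at the indicator vector, and the exponential
integrates it against independent Poisson variables. Applied to centred indicator functions, the
norm bound becomes a total variation bound (`tvDist_poisson_le`).

For permutations with prescribed first values, the modification exchanges two values so that `π i =
i + k`. If `i + k` is not among the prescribed values, this gives exactly the law conditioned on
that event, whose probability is `1 / (n - r)`; otherwise the event is impossible. There are at most
`2r(n - r)` indices. Replacing the probabilities by `1 / n` costs at most `4r² / n`, and the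
disturbed indicators cost at most `12r² / (n - r)` (`sum_card_symmDiff_sepSet_le`). -/

theorem norm_prod_sub_one_le {ι : Type*} {m : ι → 𝔸} {c : ℝ} (s : Finset ι)
    (hm : ∀ i, ‖m i‖ ≤ 1) (hc : ∀ i, ‖m i - 1‖ ≤ c) : ‖∏ i ∈ s, m i - 1‖ ≤ s.card * c := by
  classical
  induction s using Finset.induction_on with
  | empty => simp
  | insert i s hi ih =>
    rw [Finset.prod_insert hi, Finset.card_insert_of_notMem hi]
    have h : m i * ∏ j ∈ s, m j - 1 = m i * (∏ j ∈ s, m j - 1) + (m i - 1) := by ring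
    rw [h]
    refine (norm_add_le _ _).trans ?_
    have h1 : ‖m i * (∏ j ∈ s, m j - 1)‖ ≤ s.card * c :=
      (norm_mul_le _ _).trans ((mul_le_of_le_one_left (norm_nonneg _) (hm i)).trans ih)
    push_cast
    linarith [hc i]

section

variable [NormedAlgebra ℝ 𝔸] [CompleteSpace 𝔸]

theorem exp_smul_sub_one (e : 𝔸) (u : ℝ) :
    NormedSpace.exp (u • (e - 1)) = Real.exp (-u) • NormedSpace.exp (u • e) := by
  let _ : NormedAlgebra ℚ 𝔸 := NormedAlgebra.restrictScalars ℚ ℝ 𝔸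
  have h : u • (e - 1) = algebraMap ℝ 𝔸 (-u) + u • e := by
    rw [Algebra.algebraMap_eq_smul_one, smul_sub, neg_smul]; abel
  rw [h, NormedSpace.exp_add, ← NormedSpace.algebraMap_exp_comm, ← Real.exp_eq_exp_ℝ,
    Algebra.smul_def (Real.exp (-u))]

/-- The weighted configuration sums interpolating between a generating element (at `1`) and a
multivariate Poisson generating element (at `0`). -/
noncomputable def poissonInterpolation {ι X : Type*} [Fintype ι] (e : ι → 𝔸) (S : Finset X)
    (I : X → Finset ι) (l : ι → ℝ) (s : ℝ) : 𝔸 :=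
  (∑ x ∈ S, ∏ a ∈ I x, (1 + s • (e a - 1))) *
    NormedSpace.exp ((1 - s) • ∑ a, l a • (e a - 1))

/-- The product rule produces a sum over pairs `a ∈ I x`, which `hτ` rewrites as an unrestricted sum
over coupled configurations. Differentiating the exponential gives the `l a` terms with the same
factor `e a - 1`, so the two can be compared index by index. -/
theorem hasDerivAt_poissonInterpolation {ι X : Type*} [Fintype ι] [DecidableEq ι] (e : ι → 𝔸)
    (S : Finset X) (I : X → Finset ι) (l : ι → ℝ) (p : ι → ℝ) (τ : ι → X → X)
    (hτ : ∀ a (F : X → 𝔸), ∑ x ∈ S with a ∈ I x, F x = p a • ∑ x ∈ S, F (τ a x)) (s : ℝ) :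
    HasDerivAt (poissonInterpolation e S I l)
      ((∑ a, (e a - 1) * (p a • ∑ x ∈ S, ∏ b ∈ (I (τ a x)).erase a, (1 + s • (e b - 1))
        - l a • ∑ x ∈ S, ∏ b ∈ I x, (1 + s • (e b - 1)))) *
        NormedSpace.exp ((1 - s) • ∑ a, l a • (e a - 1))) s := by
  have hm : ∀ b : ι, HasDerivAt (fun s : ℝ => 1 + s • (e b - 1)) (e b - 1) s := fun b => by
    simpa using ((hasDerivAt_id s).smul_const (e b - 1)).const_add 1
  have h1 : HasDerivAt (fun s : ℝ => ∑ x ∈ S, ∏ a ∈ I x, (1 + s • (e a - 1)))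
      (∑ x ∈ S, ∑ a ∈ I x, (∏ b ∈ (I x).erase a, (1 + s • (e b - 1))) • (e a - 1)) s :=
    HasDerivAt.fun_sum fun x _ => HasDerivAt.fun_finsetProd fun b _ => hm b
  have h2 : HasDerivAt (fun s : ℝ => NormedSpace.exp ((1 - s) • ∑ a, l a • (e a - 1)))
      ((-1 : ℝ) • (NormedSpace.exp ((1 - s) • ∑ a, l a • (e a - 1)) *
        ∑ a, l a • (e a - 1))) s :=
    (hasDerivAt_exp_smul_const (𝕂 := ℝ) (∑ a, l a • (e a - 1)) (1 - s)).scomp s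
      (by simpa using (hasDerivAt_id s).const_sub 1)
  have h3 : ∑ x ∈ S, ∑ a ∈ I x, (∏ b ∈ (I x).erase a, (1 + s • (e b - 1))) • (e a - 1)
      = ∑ a, (e a - 1) * (p a • ∑ x ∈ S, ∏ b ∈ (I (τ a x)).erase a, (1 + s • (e b - 1))) := by
    have h4 : ∀ x ∈ S, ∑ a ∈ I x, (∏ b ∈ (I x).erase a, (1 + s • (e b - 1))) • (e a - 1)
        = ∑ a, if a ∈ I x then (∏ b ∈ (I x).erase a, (1 + s • (e b - 1))) • (e a - 1) else 0 := by
      intro x _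
      rw [← Finset.sum_filter]
      simp
    rw [Finset.sum_congr rfl h4, Finset.sum_comm]
    refine Finset.sum_congr rfl fun a _ => ?_
    rw [← Finset.sum_filter, ← hτ a (fun x => ∏ b ∈ (I x).erase a, (1 + s • (e b - 1))),
      Finset.mul_sum]
    exact Finset.sum_congr rfl fun x _ => by rw [smul_eq_mul, mul_comm]
  refine (h1.mul h2).congr_deriv ?_
  rw [h3]
  have h5 : ∑ a, (e a - 1) * (l a • ∑ x ∈ S, ∏ b ∈ I x, (1 + s • (e b - 1)))
      = (∑ x ∈ S, ∏ b ∈ I x, (1 + s • (e b - 1))) * ∑ a, l a • (e a - 1) := by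
    rw [Finset.mul_sum]
    exact Finset.sum_congr rfl fun a _ => by rw [mul_smul_comm, mul_smul_comm, mul_comm]
  rw [Finset.sum_congr rfl fun a _ => mul_sub (e a - 1) _ _, Finset.sum_sub_distrib, h5, neg_one_smul]
  ring

end

variable [NormOneClass 𝔸]

theorem norm_sub_one_le_two {e : 𝔸} (he : ‖e‖ ≤ 1) : ‖e - 1‖ ≤ 2 :=
  (norm_sub_le _ _).trans (by rw [norm_one]; linarith)

theorem norm_prod_le_one {ι : Type*} {m : ι → 𝔸} (s : Finset ι) (hm : ∀ i, ‖m i‖ ≤ 1) :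
    ‖∏ i ∈ s, m i‖ ≤ 1 :=
  (s.norm_prod_le m).trans (Finset.prod_le_one (fun _ _ => norm_nonneg _) fun i _ => hm i)

/-- The factors over `s ∩ t` pull out as a contraction; only those in exactly one of the sets
contribute. -/
theorem norm_prod_sub_prod_le {ι : Type*} [DecidableEq ι] {m : ι → 𝔸} {c : ℝ} (s t : Finset ι)
    (hm : ∀ i, ‖m i‖ ≤ 1) (hc : ∀ i, ‖m i - 1‖ ≤ c) :
    ‖∏ i ∈ s, m i - ∏ i ∈ t, m i‖ ≤ (symmDiff s t).card * c := by
  have hs := Finset.prod_inter_mul_prod_sdiff s t m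
  have ht := Finset.prod_inter_mul_prod_sdiff t s m
  rw [Finset.inter_comm] at ht
  have h : ∏ i ∈ s, m i - ∏ i ∈ t, m i
      = (∏ i ∈ s ∩ t, m i) * ((∏ i ∈ s \ t, m i - 1) - (∏ i ∈ t \ s, m i - 1)) := by
    rw [← hs, ← ht]; ring
  rw [h]
  refine (norm_mul_le _ _).trans ((mul_le_of_le_one_left (norm_nonneg _)
    (norm_prod_le_one _ hm)).trans ((norm_sub_le _ _).trans ?_))
  have hcard : (symmDiff s t).card = (s \ t).card + (t \ s).card := by
    rw [symmDiff_def, Finset.sup_eq_union, Finset.card_union_of_disjoint disjoint_sdiff_sdiff]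
  rw [hcard]
  push_cast
  linarith [norm_prod_sub_one_le (s \ t) hm hc, norm_prod_sub_one_le (t \ s) hm hc]

variable [NormedAlgebra ℝ 𝔸]

theorem norm_exp_le_exp_norm (x : 𝔸) : ‖NormedSpace.exp x‖ ≤ Real.exp ‖x‖ := by
  have h := (NormedSpace.expSeries_div_hasSum_exp (𝔸 := ℝ) ‖x‖)
  rw [← Real.exp_eq_exp_ℝ] at h
  rw [NormedSpace.exp_eq_tsum ℝ]
  refine tsum_of_norm_bounded h fun n => ?_
  rw [norm_smul, norm_inv, Real.norm_natCast, div_eq_inv_mul]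
  gcongr
  exact norm_pow_le x n

theorem norm_one_add_smul_sub_one_le {e : 𝔸} (he : ‖e‖ ≤ 1) {s : ℝ} (h0 : 0 ≤ s) (h1 : s ≤ 1) :
    ‖1 + s • (e - 1)‖ ≤ 1 := by
  have h : 1 + s • (e - 1) = (1 - s) • (1 : 𝔸) + s • e := by
    rw [smul_sub, sub_smul, one_smul]; abel
  rw [h]
  refine (norm_add_le _ _).trans ?_
  rw [norm_smul, norm_smul, norm_one, Real.norm_of_nonneg h0, Real.norm_of_nonneg (by linarith)]
  nlinarith

variable [CompleteSpace 𝔸]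

/-- The exponential is a Poisson average of powers of a contraction: the factor `exp (-u)` exactly
offsets `‖exp (u • e)‖ ≤ exp u`. -/
theorem norm_exp_smul_sub_one_le {e : 𝔸} (he : ‖e‖ ≤ 1) {u : ℝ} (hu : 0 ≤ u) :
    ‖NormedSpace.exp (u • (e - 1))‖ ≤ 1 := by
  rw [exp_smul_sub_one, norm_smul, Real.norm_eq_abs, abs_of_pos (Real.exp_pos _), Real.exp_neg]
  have h1 : ‖u • e‖ ≤ u := by
    rw [norm_smul, Real.norm_eq_abs, abs_of_nonneg hu]
    exact mul_le_of_le_one_right hu he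
  rw [inv_mul_le_one₀ (Real.exp_pos _)]
  exact (norm_exp_le_exp_norm _).trans (Real.exp_le_exp.2 h1)

/-- A Poisson approximation for dependent indicators by size-bias couplings, in terms of generating
elements in a commutative Banach algebra. -/
theorem norm_sum_prod_sub_smul_exp_le {ι X : Type*} [Fintype ι] [DecidableEq ι] {e : ι → 𝔸}
    (he : ∀ a, ‖e a‖ ≤ 1)
    (S : Finset X) (I : X → Finset ι) {l p : ι → ℝ} (hl : ∀ a, 0 ≤ l a) (hp : ∀ a, 0 ≤ p a)
    (τ : ι → X → X)
    (hτ : ∀ a (F : X → 𝔸), ∑ x ∈ S with a ∈ I x, F x = p a • ∑ x ∈ S, F (τ a x)) :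
    ‖∑ x ∈ S, ∏ a ∈ I x, e a - (S.card : ℝ) • NormedSpace.exp (∑ a, l a • (e a - 1))‖
      ≤ 2 * ∑ a, |p a - l a| * S.card
        + 2 * ∑ a, p a * ∑ x ∈ S, ((symmDiff ((I (τ a x)).erase a) (I x)).card : ℝ) := by
  let _ : NormedAlgebra ℚ 𝔸 := NormedAlgebra.restrictScalars ℚ ℝ 𝔸
  set C₁ := ∑ a, |p a - l a| * S.card
  set C₂ := ∑ a, p a * ∑ x ∈ S, ((symmDiff ((I (τ a x)).erase a) (I x)).card : ℝ)
  have hd := hasDerivAt_poissonInterpolation e S I l p τ hτ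
  have hexp : ∀ s ∈ Set.Ico (0 : ℝ) 1,
      ‖NormedSpace.exp ((1 - s) • ∑ a, l a • (e a - 1))‖ ≤ 1 := by
    intro s hs
    rw [Finset.smul_sum, NormedSpace.exp_sum]
    refine norm_prod_le_one _ fun a => ?_
    rw [smul_smul]
    exact norm_exp_smul_sub_one_le (he a) (mul_nonneg (by linarith [hs.2]) (hl a))
  have hbound : ∀ s ∈ Set.Ico (0 : ℝ) 1,
      ‖(∑ a, (e a - 1) * (p a • ∑ x ∈ S, ∏ b ∈ (I (τ a x)).erase a, (1 + s • (e b - 1))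
        - l a • ∑ x ∈ S, ∏ b ∈ I x, (1 + s • (e b - 1)))) *
        NormedSpace.exp ((1 - s) • ∑ a, l a • (e a - 1))‖ ≤ 2 * C₁ + 2 * C₂ * (2 * s) := by
    intro s hs
    have hm : ∀ b, ‖1 + s • (e b - 1)‖ ≤ 1 := fun b =>
      norm_one_add_smul_sub_one_le (he b) hs.1 hs.2.le
    have hc : ∀ b, ‖1 + s • (e b - 1) - 1‖ ≤ 2 * s := fun b => by
      rw [add_sub_cancel_left, norm_smul, Real.norm_of_nonneg hs.1, mul_comm]
      exact mul_le_mul_of_nonneg_right (norm_sub_one_le_two (he b)) hs.1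
    refine (norm_mul_le _ _).trans ((mul_le_of_le_one_right (norm_nonneg _) (hexp s hs)).trans ?_)
    refine (norm_sum_le _ _).trans ?_
    have hsum : 2 * C₁ + 2 * C₂ * (2 * s) = ∑ a, 2 * (|p a - l a| * S.card
        + p a * (∑ x ∈ S, ((symmDiff ((I (τ a x)).erase a) (I x)).card : ℝ)) * (2 * s)) := by
      simp only [C₁, C₂, ← Finset.mul_sum, Finset.sum_add_distrib, ← mul_assoc, ← Finset.sum_mul]
      ring
    rw [hsum]
    refine Finset.sum_le_sum fun a _ => (norm_mul_le _ _).trans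
      (mul_le_mul (norm_sub_one_le_two (he a)) ?_ (norm_nonneg _) zero_le_two)
    have hsplit : p a • ∑ x ∈ S, ∏ b ∈ (I (τ a x)).erase a, (1 + s • (e b - 1))
        - l a • ∑ x ∈ S, ∏ b ∈ I x, (1 + s • (e b - 1))
        = (p a - l a) • ∑ x ∈ S, ∏ b ∈ I x, (1 + s • (e b - 1))
          + p a • ∑ x ∈ S, (∏ b ∈ (I (τ a x)).erase a, (1 + s • (e b - 1))
            - ∏ b ∈ I x, (1 + s • (e b - 1))) := by
      rw [Finset.sum_sub_distrib, sub_smul, smul_sub]; abel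
    rw [hsplit]
    refine (norm_add_le _ _).trans (add_le_add ?_ ?_)
    · rw [norm_smul, Real.norm_eq_abs]
      refine mul_le_mul_of_nonneg_left ?_ (abs_nonneg _)
      refine (norm_sum_le _ _).trans ?_
      refine (Finset.sum_le_sum fun x _ => norm_prod_le_one (I x) hm).trans ?_
      simp
    · rw [norm_smul, Real.norm_of_nonneg (hp a), mul_assoc (p a)]
      refine mul_le_mul_of_nonneg_left ?_ (hp a)
      rw [Finset.sum_mul]
      exact (norm_sum_le _ _).trans
        (Finset.sum_le_sum fun x _ => norm_prod_sub_prod_le _ _ hm hc)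
  -- The thinned factors are within `2 * s` of `1`, and `2 * s` integrates to `1` over the unit
  -- interval; the uniform bound `2` would double the `C₂` term.
  have hB : ∀ s : ℝ, HasDerivAt (fun s => 2 * C₁ * s + 2 * C₂ * s ^ 2)
      (2 * C₁ + 2 * C₂ * (2 * s)) s := fun s => by
    refine (((hasDerivAt_id s).const_mul (2 * C₁)).add
      ((hasDerivAt_pow 2 s).const_mul (2 * C₂))).congr_deriv ?_
    simp
  have hfin := image_norm_le_of_norm_deriv_right_le_deriv_boundary (a := (0 : ℝ)) (b := 1)
    (f := fun s => poissonInterpolation e S I l s - poissonInterpolation e S I l 0)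
    (fun s _ => ((hd s).sub_const _).continuousAt.continuousWithinAt)
    (fun s _ => ((hd s).sub_const _).hasDerivWithinAt) (by simp) hB hbound
    (Set.right_mem_Icc.2 zero_le_one)
  have e1 : poissonInterpolation e S I l 1 = ∑ x ∈ S, ∏ a ∈ I x, e a := by
    simp [poissonInterpolation]
  have e0 : poissonInterpolation e S I l 0
      = (S.card : ℝ) • NormedSpace.exp (∑ a, l a • (e a - 1)) := by
    simp [poissonInterpolation, Algebra.smul_def]
  rw [← e1, ← e0]
  simpa using hfin

end BanachAlgebra

open scoped BoundedContinuousFunction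

/-! ### Shift operators on bounded functions of counts -/

section ShiftAlgebra

/-- Bounded operators on a normed space. -/
abbrev BoundedOperator (E : Type*) [NormedAddCommGroup E] [NormedSpace ℝ E] := E →L[ℝ] E

variable {ι : Type*} [DecidableEq ι]

/-- The operator on bounded functions of a vector of counts that adds one to the count `a`. -/
noncomputable def shiftCLM (a : ι) : BoundedOperator ((ι → ℕ) →ᵇ ℝ) :=
  BoundedContinuousFunction.compContinuousCLM ℝ ℝ ⟨fun x => x + Pi.single a 1, by fun_prop⟩

@[simp]
theorem shiftCLM_apply (a : ι) (f : (ι → ℕ) →ᵇ ℝ) (x : ι → ℕ) :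
    shiftCLM a f x = f (x + Pi.single a 1) := rfl

theorem shiftCLM_pow_apply (a : ι) (m : ℕ) (f : (ι → ℕ) →ᵇ ℝ) (x : ι → ℕ) :
    (shiftCLM a ^ m) f x = f (x + Pi.single a m) := by
  induction m generalizing x with
  | zero => simp
  | succ m ih =>
    rw [pow_succ', mul_apply_eq_comp, shiftCLM_apply, ih, add_assoc, ← Pi.single_add,
      add_comm 1 m]

theorem norm_shiftCLM_le_one (a : ι) : ‖shiftCLM a‖ ≤ 1 :=
  ContinuousLinearMap.opNorm_le_bound _ zero_le_one fun f => by
    rw [one_mul]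
    exact f.norm_compContinuous_le _

theorem shiftCLM_comm (a b : ι) : shiftCLM a * shiftCLM b = shiftCLM b * shiftCLM a := by
  ext f x
  simp [add_assoc, add_comm (Pi.single a 1 : ι → ℕ)]

variable (ι) in
/-- The closed algebra of operators generated by the shifts. -/
noncomputable def shiftAlgebra :
    Subalgebra ℝ (BoundedOperator ((ι → ℕ) →ᵇ ℝ)) :=
  (Algebra.adjoin ℝ (Set.range shiftCLM)).topologicalClosure

/-- Commutativity passes from the shifts to the algebra they generate, then to its closure, where
the exponentials live. -/
theorem shiftAlgebra_mul_comm (x y : shiftAlgebra ι) : x * y = y * x := by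
  have hc : IsMulCommutative (Algebra.adjoin ℝ (Set.range (shiftCLM (ι := ι)))) :=
    Algebra.isMulCommutative_adjoin ℝ
      (by rintro _ ⟨a, rfl⟩ _ ⟨b, rfl⟩; exact shiftCLM_comm a b)
  exact (Subalgebra.commSemiringTopologicalClosure
    (Algebra.adjoin ℝ (Set.range (shiftCLM (ι := ι)))) fun x y => mul_comm' x y).mul_comm x y

noncomputable instance : NormedCommRing (shiftAlgebra ι) :=
  { (inferInstance : NormedRing (shiftAlgebra ι)) with
    mul_comm := shiftAlgebra_mul_comm }

instance : Nontrivial ((ι → ℕ) →ᵇ ℝ) :=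
  ⟨0, 1, fun h => zero_ne_one (congrArg (fun f : (ι → ℕ) →ᵇ ℝ => f 0) h)⟩

instance : NormOneClass (shiftAlgebra ι) :=
  ⟨(norm_one : ‖(1 : BoundedOperator ((ι → ℕ) →ᵇ ℝ))‖ = 1)⟩

noncomputable instance : NormedAlgebra ℝ (shiftAlgebra ι) :=
  { (inferInstance : Algebra ℝ (shiftAlgebra ι)) with
    norm_smul_le := fun r x => norm_smul_le r x.1 }

instance : CompleteSpace (shiftAlgebra ι) :=
  (Subalgebra.isClosed_topologicalClosure _).completeSpace_coe

/-- The shift in the count `a`, as an element of the shift algebra. -/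
noncomputable def shiftElement (a : ι) : shiftAlgebra ι :=
  ⟨shiftCLM a, Subalgebra.le_topologicalClosure _ (Algebra.subset_adjoin ⟨a, rfl⟩)⟩

theorem norm_shiftElement_le_one (a : ι) : ‖shiftElement a‖ ≤ 1 := norm_shiftCLM_le_one a

theorem prod_shiftElement_apply (s : Finset ι) (f : (ι → ℕ) →ᵇ ℝ) (x : ι → ℕ) :
    (∏ a ∈ s, shiftElement a).1 f x = f (x + ∑ a ∈ s, Pi.single a 1) := by
  induction s using Finset.induction_on generalizing x with
  | empty => simp
  | insert a s ha ih =>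
    rw [Finset.prod_insert ha, Finset.sum_insert ha]
    change shiftCLM a ((∏ a ∈ s, shiftElement a).1 f) x = _
    rw [shiftCLM_apply, ih, add_assoc]

theorem exp_shiftElement_apply (a : ι) (l : ℝ≥0) (f : (ι → ℕ) →ᵇ ℝ) (x : ι → ℕ) :
    (NormedSpace.exp ((l : ℝ) • (shiftElement a - 1))).1 f x
      = ∫ m, f (x + Pi.single a m) ∂(poissonMeasure l) := by
  rw [integral_poissonMeasure, exp_smul_sub_one]
  have h := NormedSpace.exp_series_hasSum_exp' (𝕂 := ℝ) ((l : ℝ) • shiftElement a)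
  let ev : shiftAlgebra ι →L[ℝ] ℝ :=
    ((BoundedContinuousFunction.evalCLM ℝ x).comp
      (ContinuousLinearMap.apply ℝ ((ι → ℕ) →ᵇ ℝ) f)).comp
      (LinearMap.mkContinuous (shiftAlgebra ι).val.toLinearMap 1 fun y => (one_mul ‖y‖).ge)
  have hev : ∀ y : shiftAlgebra ι, ev y = y.1 f x := fun _ => rfl
  have h2 := ((h.mapL ev).mul_left (Real.exp (-l))).tsum_eq
  rw [← hev, map_smul, smul_eq_mul, ← h2]
  refine tsum_congr fun m => ?_
  rw [smul_pow, map_smul, map_smul, hev]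
  have h3 : (shiftElement a ^ m).1 f x = f (x + Pi.single a m) := shiftCLM_pow_apply a m f x
  rw [h3]
  simp only [smul_eq_mul]
  ring

end ShiftAlgebra

/-! ### Exponentials of shifts as Poisson expectations -/

section PoissonLaw

theorem ProbabilityTheory.IndepFun.integral_comp_add {M Ω' : Type*} [AddCommMonoid M]
    [MeasurableSpace M] [Countable M] [DiscreteMeasurableSpace M]
    {_ : MeasurableSpace Ω'} {ν : Measure Ω'} [IsProbabilityMeasure ν] {V W : Ω' → M}
    (hVW : IndepFun V W ν) (hV : AEMeasurable V ν) (hW : AEMeasurable W ν) {f : M → ℝ} {C : ℝ}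
    (hf : ∀ x, ‖f x‖ ≤ C) :
    ∫ ω, f (V ω + W ω) ∂ν = ∫ ω, ∫ w, f (V ω + w) ∂(ν.map W) ∂ν := by
  have := Measure.isProbabilityMeasure_map hV
  have := Measure.isProbabilityMeasure_map hW
  rw [← integral_map (φ := fun ω => (V ω, W ω)) (f := fun p => f (p.1 + p.2))
    (hV.prodMk hW) (Measurable.of_discrete.aestronglyMeasurable),
    (indepFun_iff_map_prod_eq_prod_map_map hV hW).1 hVW, integral_prod,
    ← integral_map (φ := V) (f := fun v => ∫ w, f (v + w) ∂(ν.map W)) hV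
      (Measurable.of_discrete.aestronglyMeasurable)]
  exact Integrable.of_bound (Measurable.of_discrete.aestronglyMeasurable) C
    (Filter.Eventually.of_forall fun p => hf _)

variable {ι : Type*} [Fintype ι] [DecidableEq ι]
  {Ω' : Type*} [MeasurableSpace Ω'] {ν : Measure Ω'} [IsProbabilityMeasure ν]

/-- Each factor averages over one Poisson coordinate, and independence lets these averages be
composed. The induction varies `f` because the factor split off acts on `f` first. -/
theorem prod_exp_shiftElement_apply {l : ι → ℝ≥0} {Z : ι → Ω' → ℕ}
    (hZ : ∀ a, HasLaw (Z a) (poissonMeasure (l a)) ν) (hind : iIndepFun Z ν)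
    (s : Finset ι) (f : (ι → ℕ) →ᵇ ℝ) (x : ι → ℕ) :
    (∏ a ∈ s, NormedSpace.exp ((l a : ℝ) • (shiftElement a - 1))).1 f x
      = ∫ ω, f (x + ∑ a ∈ s, Pi.single a (Z a ω)) ∂ν := by
  induction s using Finset.induction_on generalizing f x with
  | empty => simp
  | insert a s ha ih =>
    set V : ι → Ω' → (ι → ℕ) := fun a ω => Pi.single a (Z a ω) with hV
    have hmeas : ∀ a, AEMeasurable (V a) ν := fun a =>
      (Measurable.of_discrete (f := fun m : ℕ => (Pi.single a m : ι → ℕ))).comp_aemeasurable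
        (hZ a).aemeasurable
    have hVind : iIndepFun V ν :=
      hind.comp (fun a (m : ℕ) => (Pi.single a m : ι → ℕ)) fun a => Measurable.of_discrete
    have hsum : AEMeasurable (∑ b ∈ s, V b) ν := Finset.aemeasurable_sum s fun b _ => hmeas b
    have hindep := hVind.indepFun_finsetSum_of_notMem₀ hmeas ha
    have key := hindep.integral_comp_add hsum (hmeas a)
      (f := fun y => f (x + y)) (C := ‖f‖) fun y => f.norm_coe_le_norm _
    have hinner : ∀ v : ι → ℕ, ∫ w, f (x + (v + w)) ∂(ν.map (V a))
        = (NormedSpace.exp ((l a : ℝ) • (shiftElement a - 1))).1 f (x + v) := by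
      intro v
      rw [exp_shiftElement_apply, ← (hZ a).map_eq, integral_map (hmeas a)
        Measurable.of_discrete.aestronglyMeasurable, integral_map (hZ a).aemeasurable
        Measurable.of_discrete.aestronglyMeasurable]
      simp only [hV, add_assoc]
    rw [Finset.prod_insert ha, mul_comm]
    change (∏ a ∈ s, NormedSpace.exp ((l a : ℝ) • (shiftElement a - 1))).1
      ((NormedSpace.exp ((l a : ℝ) • (shiftElement a - 1))).1 f) x = _
    rw [ih]
    simp only [hinner] at key
    have hgoal : ∀ ω, f (x + ∑ b ∈ insert a s, Pi.single b (Z b ω))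
        = f (x + ((∑ b ∈ s, V b) ω + V a ω)) := fun ω => by
      rw [Finset.sum_insert ha, Finset.sum_apply]
      exact congrArg (fun y => f (x + y)) (add_comm _ _)
    simp only [hgoal, key]
    simp only [Finset.sum_apply, hV]

/-- The mean of a bounded function of independent Poisson counts, through the exponential of the
generator. -/
theorem exp_sum_shiftElement_apply_zero {l : ι → ℝ≥0} {Z : ι → Ω' → ℕ}
    (hZ : ∀ a, HasLaw (Z a) (poissonMeasure (l a)) ν) (hind : iIndepFun Z ν)
    (f : (ι → ℕ) →ᵇ ℝ) :
    (NormedSpace.exp (∑ a, (l a : ℝ) • (shiftElement a - 1))).1 f 0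
      = ∫ ω, f (fun a => Z a ω) ∂ν := by
  let _ : NormedAlgebra ℚ (shiftAlgebra ι) := NormedAlgebra.restrictScalars ℚ ℝ (shiftAlgebra ι)
  rw [NormedSpace.exp_sum, prod_exp_shiftElement_apply hZ hind]
  refine integral_congr_ae (Filter.Eventually.of_forall fun ω => ?_)
  simp only [zero_add]
  congr 1
  exact Finset.univ_sum_single fun a => Z a ω

end PoissonLaw

/-! ### From operator norms to total variation -/

section TotalVariation

universe u

variable {ι : Type u} [Fintype ι] [DecidableEq ι]
  {Ω' : Type*} [MeasurableSpace Ω'] {ν : Measure Ω'} [IsProbabilityMeasure ν]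

/-- Poisson process approximation by size-bias couplings: `τ a x` is the configuration `x` modified
so as to contain `a`. -/
theorem tvDist_poisson_le {X : Type*} (S : Finset X) (hS : S.Nonempty) (I : X → Finset ι)
    {l : ι → ℝ≥0} {p : ι → ℝ} (hp : ∀ a, 0 ≤ p a) (τ : ι → X → X)
    (hτ : ∀ (M : Type u) [AddCommGroup M] [Module ℝ M] (a : ι) (F : X → M),
      ∑ x ∈ S with a ∈ I x, F x = p a • ∑ x ∈ S, F (τ a x))
    {Z : ι → Ω' → ℕ} (hZ : ∀ a, HasLaw (Z a) (poissonMeasure (l a)) ν) (hind : iIndepFun Z ν)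
    {P : Measure (ι → ℕ)}
    (hP : ∀ A : Set (ι → ℕ),
      P.real A = (∑ x ∈ S, A.indicator 1 (∑ a ∈ I x, (Pi.single a 1 : ι → ℕ))) / (S.card : ℝ)) :
    tvDist P (ν.map fun ω a => Z a ω)
      ≤ ∑ a, |p a - l a|
        + (∑ a, p a * ∑ x ∈ S, ((symmDiff ((I (τ a x)).erase a) (I x)).card : ℝ)) / S.card := by
  have hcard : (0 : ℝ) < S.card := by exact_mod_cast hS.card_pos
  have hZm : AEMeasurable (fun ω a => Z a ω) ν := aemeasurable_pi_lambda _ fun a =>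
    (hZ a).aemeasurable
  have : Nonempty {A : Set (ι → ℕ) // MeasurableSet A} := ⟨⟨∅, MeasurableSet.empty⟩⟩
  refine ciSup_le fun A => ?_
  obtain ⟨A, hA⟩ := A
  simp only
  -- Subtracting `1 / 2` leaves differences of expectations unchanged and halves the sup norm, which
  -- cancels the factor `2` in the norm bound.
  let f : (ι → ℕ) →ᵇ ℝ := BoundedContinuousFunction.ofNormedAddCommGroup
    (fun x => A.indicator 1 x - 1 / 2) continuous_of_discreteTopology (1 / 2) fun x => by
      by_cases hx : x ∈ A <;> norm_num [hx]
  have hf : ‖f‖ ≤ 1 / 2 :=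
    BoundedContinuousFunction.norm_ofNormedAddCommGroup_le _ (by norm_num) _
  have hfx : ∀ x, f x = A.indicator 1 x - 1 / 2 := fun _ => rfl
  have hbound := norm_sum_prod_sub_smul_exp_le (norm_shiftElement_le_one (ι := ι)) S I
    (fun a => (l a).coe_nonneg) hp τ (fun a F => hτ _ a F)
  set D := ∑ x ∈ S, ∏ a ∈ I x, shiftElement a
    - (S.card : ℝ) • NormedSpace.exp (∑ a, (l a : ℝ) • (shiftElement a - 1)) with hD
  have hDf : D.1 f 0 = S.card * (P.real A - (ν.map fun ω a => Z a ω).real A) := by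
    have h1 : D.1 f 0 = ∑ x ∈ S, (∏ a ∈ I x, shiftElement a).1 f 0
        - S.card * (NormedSpace.exp (∑ a, (l a : ℝ) • (shiftElement a - 1))).1 f 0 := by
      rw [hD]
      simp
    rw [h1, exp_sum_shiftElement_apply_zero hZ hind, hP A,
      ← integral_map (φ := fun ω a => Z a ω) (f := f) hZm
        Measurable.of_discrete.aestronglyMeasurable]
    have := Measure.isProbabilityMeasure_map hZm
    simp only [hfx, prod_shiftElement_apply, zero_add]
    rw [integral_sub ((integrable_const 1).indicator hA) (integrable_const _),
      integral_indicator_one hA]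
    simp only [Finset.sum_sub_distrib, Finset.sum_const, nsmul_eq_mul, integral_const,
      probReal_univ, smul_eq_mul]
    field_simp
    ring
  have h2 : |D.1 f 0| ≤ ‖D‖ * (1 / 2) :=
    (BoundedContinuousFunction.norm_coe_le_norm _ _).trans
      ((D.1.le_opNorm f).trans (mul_le_mul_of_nonneg_left hf (norm_nonneg _)))
  rw [hDf, abs_mul, abs_of_pos hcard] at h2
  rw [← sub_le_iff_le_add', le_div_iff₀ hcard]
  rw [← Finset.sum_mul] at hbound
  linarith

end TotalVariation

/-! ### Uniform permutations with prescribed values -/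

section PrescribedValues

variable {α : Type*} [Fintype α] [DecidableEq α]

/-- The permutations that agree with `c` on `P`. -/
def permsAgreeing (P : Finset α) (c : α → α) : Finset (Equiv.Perm α) :=
  {π | ∀ x ∈ P, π x = c x}

theorem mem_permsAgreeing {P : Finset α} {c : α → α} {π : Equiv.Perm α} :
    π ∈ permsAgreeing P c ↔ ∀ x ∈ P, π x = c x := by
  simp [permsAgreeing]

theorem apply_notMem_image_of_mem_permsAgreeing {P : Finset α} {c : α → α} {π : Equiv.Perm α}
    (hπ : π ∈ permsAgreeing P c) {i : α} (hi : i ∉ P) : π i ∉ P.image c := by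
  intro h
  obtain ⟨x, hx, hxi⟩ := Finset.mem_image.1 h
  rw [← mem_permsAgreeing.1 hπ x hx] at hxi
  exact hi (π.injective hxi ▸ hx)

theorem swap_mul_mem_permsAgreeing {P : Finset α} {c : α → α} {π : Equiv.Perm α}
    (hπ : π ∈ permsAgreeing P c) {u v : α} (hu : u ∉ P.image c) (hv : v ∉ P.image c) :
    Equiv.swap u v * π ∈ permsAgreeing P c := by
  rw [mem_permsAgreeing] at hπ ⊢
  intro x hx
  rw [Equiv.Perm.mul_apply, hπ x hx]
  exact Equiv.swap_apply_of_ne_of_ne (fun h => hu (h ▸ Finset.mem_image_of_mem c hx))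
    (fun h => hv (h ▸ Finset.mem_image_of_mem c hx))

/-- Exchanging values so that `i` is sent to `v` maps uniform permutations onto uniform permutations
sending `i` to `v`. -/
theorem sum_permsAgreeing_swap_mul {M : Type*} [AddCommMonoid M] {P : Finset α} {c : α → α}
    {i v : α} (hi : i ∉ P) (hv : v ∉ P.image c) (F : Equiv.Perm α → M) :
    ∑ π ∈ permsAgreeing P c, F (Equiv.swap (π i) v * π)
      = (P.image c)ᶜ.card • ∑ π ∈ permsAgreeing P c with π i = v, F π := by
  rw [← Finset.sum_fiberwise_of_maps_to (t := (P.image c)ᶜ) (g := fun π => π i)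
    (fun π hπ => Finset.mem_compl.2 (apply_notMem_image_of_mem_permsAgreeing hπ hi)),
    ← Finset.sum_const]
  refine Finset.sum_congr rfl fun u hu => ?_
  rw [Finset.mem_compl] at hu
  refine Finset.sum_bij' (fun π _ => Equiv.swap u v * π) (fun π _ => Equiv.swap u v * π)
    ?_ ?_ ?_ ?_ ?_
  · intro π hπ
    rw [Finset.mem_filter] at hπ ⊢
    exact ⟨swap_mul_mem_permsAgreeing hπ.1 hu hv, by simp [hπ.2]⟩
  · intro π hπ
    rw [Finset.mem_filter] at hπ ⊢
    exact ⟨swap_mul_mem_permsAgreeing hπ.1 hu hv, by simp [hπ.2]⟩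
  · intro π _
    simp [← mul_assoc]
  · intro π _
    simp [← mul_assoc]
  · intro π hπ
    rw [(Finset.mem_filter.1 hπ).2]

/-- A value already used is impossible, and any other is equally likely by
`sum_permsAgreeing_swap_mul`. Only an inequality holds in general, as `c` need not be injective on
`P`. -/
theorem card_permsAgreeing_filter_mul_le {P : Finset α} (c : α → α) {i : α} (hi : i ∉ P) (v : α) :
    (Fintype.card α - P.card) * ({π ∈ permsAgreeing P c | π i = v} : Finset _).card
      ≤ (permsAgreeing P c).card := by
  by_cases hv : v ∈ P.image c
  · have h : ({π ∈ permsAgreeing P c | π i = v} : Finset _) = ∅ :=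
      Finset.filter_eq_empty_iff.2 fun π hπ h =>
        apply_notMem_image_of_mem_permsAgreeing hπ hi (h ▸ hv)
    simp [h]
  · have h := sum_permsAgreeing_swap_mul (c := c) hi hv (fun _ => (1 : ℕ))
    simp only [Finset.sum_const, smul_eq_mul, mul_one] at h
    rw [h, Finset.card_compl]
    exact Nat.mul_le_mul_right _ (Nat.sub_le_sub_left Finset.card_image_le _)

/-- Requiring `π i = u` prescribes one more value, so the one-position bound applies twice. -/
theorem card_permsAgreeing_filter_two_mul_le {P : Finset α} (c : α → α) {i j : α} (hi : i ∉ P)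
    (hj : j ∉ P) (hij : i ≠ j) (u v : α) :
    (Fintype.card α - P.card) * ((Fintype.card α - P.card - 1) *
        ({π ∈ permsAgreeing P c | π i = u ∧ π j = v} : Finset _).card)
      ≤ (permsAgreeing P c).card := by
  have hext : permsAgreeing (insert i P) (Function.update c i u)
      = ({π ∈ permsAgreeing P c | π i = u} : Finset _) := by
    ext π
    simp only [mem_permsAgreeing, Finset.mem_filter, Finset.forall_mem_insert,
      Function.update_self]
    rw [and_comm]
    refine and_congr_left fun _ => forall₂_congr fun x hx => ?_
    rw [Function.update_of_ne (ne_of_mem_of_not_mem hx hi)]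
  have hj' : j ∉ insert i P := by simp [hj, hij.symm]
  have h := card_permsAgreeing_filter_mul_le (Function.update c i u) hj' v
  rw [hext, Finset.filter_filter, Finset.card_insert_of_notMem hi, ← Nat.sub_sub] at h
  exact (Nat.mul_le_mul_left _ h).trans (card_permsAgreeing_filter_mul_le c hi u)

theorem permsAgreeing_nonempty {P : Finset α} {c : α → α} (hc : Set.InjOn c P) :
    (permsAgreeing P c).Nonempty := by
  let e : {x // x ∈ P} ≃ {x // x ∈ P.image c} :=
    Equiv.ofBijective (fun x => ⟨c x, Finset.mem_image_of_mem c x.2⟩)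
      ⟨fun x y h => Subtype.ext (hc x.2 y.2 (congrArg Subtype.val h)), fun y => by
        obtain ⟨x, hx, hxy⟩ := Finset.mem_image.1 y.2
        exact ⟨⟨x, hx⟩, Subtype.ext hxy⟩⟩
  exact ⟨e.extendSubtype, mem_permsAgreeing.2 fun x hx => e.extendSubtype_apply_of_mem x hx⟩

end PrescribedValues

/-! ### Separation events and the effect of a swap -/

section Separation

variable {n r : ℕ}

theorem mem_sepIndex {p : Fin n × ℤ} :
    p ∈ sepIndex n r ↔ (-(r : ℤ) + 1 ≤ p.2 ∧ p.2 ≤ (r : ℤ) - 1) ∧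
      r ≤ (p.1 : ℕ) ∧ 0 ≤ ((p.1 : ℕ) : ℤ) + p.2 ∧ ((p.1 : ℕ) : ℤ) + p.2 < (n : ℤ) := by
  simp [sepIndex]

/-- The value `i + k` prescribed by the index `(i, k)`. -/
def sepTarget (b : sepIndex n r) : Fin n :=
  ⟨(((b.1.1 : ℕ) : ℤ) + b.1.2).toNat, by have := (mem_sepIndex.1 b.2).2; omega⟩

theorem sepTarget_val (b : sepIndex n r) :
    ((sepTarget b : ℕ) : ℤ) = ((b.1.1 : ℕ) : ℤ) + b.1.2 := by
  have := (mem_sepIndex.1 b.2).2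
  simp only [sepTarget]
  omega

theorem isSeparated_iff (π : Equiv.Perm (Fin n)) (b : sepIndex n r) :
    IsSeparated π b.1.1 b.1.2 ↔ π b.1.1 = sepTarget b := by
  rw [IsSeparated, ← sepTarget_val, Fin.ext_iff]
  exact Nat.cast_inj

theorem sepIndex_ext {b b' : sepIndex n r} (h₁ : b.1.1 = b'.1.1)
    (h₂ : sepTarget b = sepTarget b') : b = b' := by
  have e := sepTarget_val b
  have e' := sepTarget_val b'
  rw [h₁, h₂] at e
  exact Subtype.ext (Prod.ext h₁ (by omega))

theorem le_position (b : sepIndex n r) : r ≤ (b.1.1 : ℕ) := (mem_sepIndex.1 b.2).2.1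

theorem card_offsets_le : (Finset.Icc (-(r : ℤ) + 1) ((r : ℤ) - 1)).card ≤ 2 * r := by
  rw [Int.card_Icc]
  omega

theorem offset_mem (b : sepIndex n r) :
    b.1.2 ∈ Finset.Icc (-(r : ℤ) + 1) ((r : ℤ) - 1) :=
  Finset.mem_Icc.2 (mem_sepIndex.1 b.2).1

/-- Few indices have their position in a given set. -/
theorem card_filter_position_mem_le (Q : Finset (Fin n)) :
    ({b : sepIndex n r | b.1.1 ∈ Q} : Finset _).card ≤ Q.card * (2 * r) := by
  refine le_trans ?_ (Nat.mul_le_mul_left _ card_offsets_le)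
  rw [← Finset.card_product]
  refine Finset.card_le_card_of_injOn (fun b => (b.1.1, b.1.2)) ?_ ?_
  · intro b hb
    simp only [Finset.coe_filter, Set.mem_ofPred_eq, Finset.mem_univ, true_and] at hb
    exact Finset.mem_coe.2 (Finset.mem_product.2 ⟨hb, offset_mem b⟩)
  · intro b _ b' _ h
    exact Subtype.ext h

/-- Few indices have their prescribed value in a given set. -/
theorem card_filter_sepTarget_mem_le (Q : Finset (Fin n)) :
    ({b : sepIndex n r | sepTarget b ∈ Q} : Finset _).card ≤ Q.card * (2 * r) := by
  refine le_trans ?_ (Nat.mul_le_mul_left _ card_offsets_le)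
  rw [← Finset.card_product]
  refine Finset.card_le_card_of_injOn (fun b => (sepTarget b, b.1.2)) ?_ ?_
  · intro b hb
    simp only [Finset.coe_filter, Set.mem_ofPred_eq, Finset.mem_univ, true_and] at hb
    exact Finset.mem_coe.2 (Finset.mem_product.2 ⟨hb, offset_mem b⟩)
  · intro b _ b' _ h
    obtain ⟨h1, h2⟩ := Prod.ext_iff.1 h
    have e := sepTarget_val b
    have e' := sepTarget_val b'
    simp only at h1 h2
    rw [h1] at e
    exact sepIndex_ext (Fin.ext (by omega)) h1

/-- The indices whose separation event occurs in `π`. -/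
noncomputable def sepSet (r : ℕ) (π : Equiv.Perm (Fin n)) : Finset (sepIndex n r) :=
  {b | π b.1.1 = sepTarget b}

theorem mem_sepSet {π : Equiv.Perm (Fin n)} {b : sepIndex n r} :
    b ∈ sepSet r π ↔ π b.1.1 = sepTarget b := by
  simp [sepSet]

theorem sepIndicators_eq_sum_single (π : Equiv.Perm (Fin n)) :
    sepIndicators n r π = ∑ b ∈ sepSet r π, (Pi.single b 1 : sepIndex n r → ℕ) := by
  classical
  ext b
  simp only [sepIndicators, isSeparated_iff, Finset.sum_apply, Pi.single_apply,
    Finset.sum_ite_eq, mem_sepSet]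

/-- The indices whose events may change when the values `π i` and `v` are exchanged. -/
theorem card_symmDiff_sepSet_swap_le (π : Equiv.Perm (Fin n)) (a : sepIndex n r) :
    (symmDiff ((sepSet r (Equiv.swap (π a.1.1) (sepTarget a) * π)).erase a) (sepSet r π)).card
      ≤ ({b : sepIndex n r | b.1.1 = a.1.1 ∧ π a.1.1 = sepTarget b} : Finset _).card
        + ({b : sepIndex n r | sepTarget b = sepTarget a ∧ π b.1.1 = sepTarget a} : Finset _).card
        + ({b : sepIndex n r | (b.1.1 ≠ a.1.1 ∧ sepTarget b ≠ sepTarget a) ∧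
            π b.1.1 = sepTarget a ∧ π a.1.1 = sepTarget b} : Finset _).card := by
  refine le_trans (Finset.card_le_card ?_)
    ((Finset.card_union_le _ _).trans (Nat.add_le_add_right (Finset.card_union_le _ _) _))
  intro b hb
  simp only [Finset.mem_symmDiff, Finset.mem_erase, mem_sepSet, Equiv.Perm.mul_apply] at hb
  simp only [Finset.mem_union, Finset.mem_filter, Finset.mem_univ, true_and]
  -- The swap alters `π` only at the position of `a` and at the position that held `sepTarget a`. At
  -- the former, the only event that can occur afterwards is `a` itself, which is erased, so other
  -- events there can only be lost.
  by_cases h1 : b.1.1 = a.1.1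
  · rw [h1, Equiv.swap_apply_left] at hb
    rcases hb with ⟨⟨hne, h⟩, _⟩ | ⟨h, _⟩
    · exact absurd (sepIndex_ext h1 h.symm) hne
    · exact Or.inl (Or.inl ⟨h1, h⟩)
  · by_cases h2 : π b.1.1 = sepTarget a
    · rw [h2, Equiv.swap_apply_right] at hb
      rcases hb with ⟨⟨_, h⟩, h'⟩ | ⟨h, _⟩
      · exact Or.inr ⟨⟨h1, fun e => h' e.symm⟩, h2, h⟩
      · exact Or.inl (Or.inr ⟨h.symm, h2⟩)
    · have h3 : Equiv.swap (π a.1.1) (sepTarget a) (π b.1.1) = π b.1.1 :=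
        Equiv.swap_apply_of_ne_of_ne (fun h => h1 (π.injective h)) h2
      rw [h3] at hb
      rcases hb with ⟨⟨_, h⟩, h'⟩ | ⟨h, h'⟩
      · exact absurd h h'
      · exact absurd ⟨fun e => h1 (by rw [e]), h⟩ h'

variable {c : Fin n → Fin n}

/-- The first `r` positions. -/
def firstPositions (n r : ℕ) : Finset (Fin n) := {x | (x : ℕ) < r}

theorem mem_firstPositions {x : Fin n} : x ∈ firstPositions n r ↔ (x : ℕ) < r := by
  simp [firstPositions]

theorem card_firstPositions (h : r ≤ n) : (firstPositions n r).card = r := by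
  simp [firstPositions, Fin.card_filter_val_lt, h]

theorem position_notMem_firstPositions (b : sepIndex n r) : b.1.1 ∉ firstPositions n r := by
  rw [mem_firstPositions]
  exact (le_position b).not_gt

theorem sum_card_filter_comm {X ι : Type*} [Fintype ι] (S : Finset X) (B : ι → Prop)
    [DecidablePred B] (R : X → ι → Prop) [∀ x i, Decidable (R x i)] :
    ∑ x ∈ S, ({b | B b ∧ R x b} : Finset ι).card = ∑ b with B b, ({x ∈ S | R x b} : Finset X).card := by
  simp only [Finset.card_filter, Finset.sum_filter, ite_and]
  rw [Finset.sum_comm]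
  refine Finset.sum_congr rfl fun b _ => ?_
  split_ifs <;> simp

/-- Size-biasing changes few indicators on average. -/
theorem sum_card_symmDiff_sepSet_le (hrn : r + 1 < n) (a : sepIndex n r) :
    (n - r) * ∑ π ∈ permsAgreeing (firstPositions n r) c,
      (symmDiff ((sepSet r (Equiv.swap (π a.1.1) (sepTarget a) * π)).erase a)
        (sepSet r π)).card
      ≤ 6 * r * (permsAgreeing (firstPositions n r) c).card := by
  set S := permsAgreeing (firstPositions n r) c with hS
  have hP : Fintype.card (Fin n) - (firstPositions n r).card = n - r := by
    rw [card_firstPositions (by omega), Fintype.card_fin]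
  have one : ∀ (b : sepIndex n r) (v : Fin n),
      (n - r) * ({π ∈ S | π b.1.1 = v} : Finset _).card ≤ S.card := fun b v => by
    simpa only [hP] using
      card_permsAgreeing_filter_mul_le c (position_notMem_firstPositions b) v
  have two : ∀ b : sepIndex n r, b.1.1 ≠ a.1.1 →
      (n - r) * ((n - r - 1) *
        ({π ∈ S | π b.1.1 = sepTarget a ∧ π a.1.1 = sepTarget b} : Finset _).card) ≤ S.card :=
    fun b hb => by
      simpa only [hP] using
        card_permsAgreeing_filter_two_mul_le c (position_notMem_firstPositions b)
          (position_notMem_firstPositions a) hb (sepTarget a) (sepTarget b)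
  have e1 : (n - r) * ∑ π ∈ S,
      ({b : sepIndex n r | b.1.1 = a.1.1 ∧ π a.1.1 = sepTarget b} : Finset _).card
      ≤ 2 * r * S.card := by
    rw [sum_card_filter_comm, Finset.mul_sum]
    refine (Finset.sum_le_card_nsmul _ _ S.card fun b _ => one a _).trans ?_
    rw [smul_eq_mul]
    refine Nat.mul_le_mul_right _ ?_
    simpa using card_filter_position_mem_le (r := r) {a.1.1}
  have e2 : (n - r) * ∑ π ∈ S,
      ({b : sepIndex n r | sepTarget b = sepTarget a ∧ π b.1.1 = sepTarget a} : Finset _).card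
      ≤ 2 * r * S.card := by
    rw [sum_card_filter_comm, Finset.mul_sum]
    refine (Finset.sum_le_card_nsmul _ _ S.card fun b _ => one b _).trans ?_
    rw [smul_eq_mul]
    refine Nat.mul_le_mul_right _ ?_
    simpa using card_filter_sepTarget_mem_le (r := r) {sepTarget a}
  have e3 : (n - r) * ∑ π ∈ S,
      ({b : sepIndex n r | (b.1.1 ≠ a.1.1 ∧ sepTarget b ≠ sepTarget a) ∧
        π b.1.1 = sepTarget a ∧ π a.1.1 = sepTarget b} : Finset _).card
      ≤ 2 * r * S.card := by
    -- Both positions are constrained here, so each `b` has probability at most `1 / ((n - r) * (n -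
    -- r - 1))`. This is offset by the larger number of candidates: `n - r - 1` positions with at
    -- most `2 * r` offsets each.
    refine (Nat.mul_le_mul_left_iff (show 0 < n - r - 1 by omega)).1 ?_
    rw [sum_card_filter_comm, ← mul_assoc, Finset.mul_sum]
    refine (Finset.sum_le_card_nsmul _ _ S.card fun b hb => ?_).trans ?_
    · rw [mul_assoc, mul_left_comm]
      exact two b (Finset.mem_filter.1 hb).2.1
    · rw [smul_eq_mul, ← mul_assoc]
      refine Nat.mul_le_mul_right _ ?_
      have hcard : ((firstPositions n r)ᶜ.erase a.1.1).card = n - r - 1 := by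
        rw [Finset.card_erase_of_mem
          (Finset.mem_compl.2 (position_notMem_firstPositions a)), Finset.card_compl, hP]
      rw [← hcard]
      refine le_trans (Finset.card_le_card fun b hb => ?_) (card_filter_position_mem_le _)
      simp only [Finset.mem_filter, Finset.mem_univ, true_and, Finset.mem_erase,
        Finset.mem_compl] at hb ⊢
      exact ⟨hb.1, position_notMem_firstPositions b⟩
  have hle := Nat.mul_le_mul_left (n - r)
    (Finset.sum_le_sum fun π (_ : π ∈ S) => card_symmDiff_sepSet_swap_le π a)
  refine hle.trans ?_
  rw [Finset.sum_add_distrib, Finset.sum_add_distrib, mul_add, mul_add]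
  linarith

theorem card_sepIndex_le (h : r ≤ n) : Fintype.card (sepIndex n r) ≤ (n - r) * (2 * r) := by
  have hcard : (firstPositions n r)ᶜ.card = n - r := by
    rw [Finset.card_compl, card_firstPositions h, Fintype.card_fin]
  rw [← hcard]
  refine le_trans ?_ (card_filter_position_mem_le _)
  rw [Finset.filter_true_of_mem fun b _ =>
    Finset.mem_compl.2 (position_notMem_firstPositions b), Finset.card_univ]

end Separation

/-! ### Conditioned laws, error sums and the final bound -/

section ConditionedPermutation

theorem uniformOn_univ_real_finset {X : Type*} [Fintype X] [MeasurableSpace X]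
    [MeasurableSingletonClass X] (T : Finset X) :
    (uniformOn (Set.univ : Set X)).real T = T.card / (Fintype.card X : ℝ) := by
  rw [measureReal_def, uniformOn_univ, Measure.count_apply_finset, ENNReal.toReal_div]
  simp

/-- The law of a function of a uniformly random element conditioned to lie in `S`. -/
theorem cond_map_real_of_hasLaw_uniformOn {X Y Ω : Type*} [Fintype X] [Nonempty X] [DecidableEq X]
    [MeasurableSpace X] [DiscreteMeasurableSpace X] [MeasurableSpace Y] [MeasurableSpace Ω]
    {μ : Measure Ω} [IsProbabilityMeasure μ] {π : Ω → X} (hπ : HasLaw π (uniformOn Set.univ) μ)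
    (S : Finset X) (g : X → Y) {A : Set Y} (hA : MeasurableSet A) :
    ((cond μ (π ⁻¹' S)).map fun ω => g (π ω)).real A
      = (∑ x ∈ S, A.indicator 1 (g x)) / (S.card : ℝ) := by
  classical
  have hpre : ∀ T : Finset X, μ.real (π ⁻¹' T) = T.card / (Fintype.card X : ℝ) := fun T => by
    rw [← uniformOn_univ_real_finset, ← hπ.map_eq, measureReal_def, measureReal_def,
      Measure.map_apply_of_aemeasurable hπ.aemeasurable T.measurableSet]
  have hS : NullMeasurableSet (π ⁻¹' S) μ :=
    hπ.aemeasurable.nullMeasurableSet_preimage S.measurableSet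
  have hm : AEMeasurable (fun ω => g (π ω)) (cond μ (π ⁻¹' S)) :=
    (Measurable.of_discrete (f := g)).comp_aemeasurable
      (hπ.aemeasurable.mono_ac cond_absolutelyContinuous)
  have hset : (fun ω => g (π ω)) ⁻¹' A ∩ π ⁻¹' S = π ⁻¹' ({x ∈ S | g x ∈ A} : Finset X) := by
    ext ω
    simp [and_comm]
  have hsum : ∑ x ∈ S, A.indicator (1 : Y → ℝ) (g x) = ({x ∈ S | g x ∈ A} : Finset X).card := by
    simp [Set.indicator_apply]
  have hcard : (Fintype.card X : ℝ) ≠ 0 := by exact_mod_cast Fintype.card_ne_zero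
  rw [measureReal_def, Measure.map_apply_of_aemeasurable hm hA, ProbabilityTheory.cond, Measure.smul_apply,
    Measure.restrict_apply₀' hS, hset, smul_eq_mul, ENNReal.toReal_mul, ENNReal.toReal_inv,
    ← measureReal_def, ← measureReal_def, hpre, hpre, hsum]
  field_simp

end ConditionedPermutation

/-- Since `1 / (n - r) - 1 / n = r / (n * (n - r))`, at most `2r(n - r)` such terms give `2r² / n`;
at most `2r²` impossible events, each costing `1 / n`, give the same again. -/
theorem sum_abs_sub_le_of_card {ι : Type*} [Fintype ι] (G : ι → Prop) [DecidablePred G]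
    {n r : ℕ} (hrn : r + 1 < n) (hcard : Fintype.card ι ≤ (n - r) * (2 * r))
    (hbad : ({a | ¬ G a} : Finset ι).card ≤ r * (2 * r)) :
    ∑ a, |(if G a then ((n - r : ℕ) : ℝ)⁻¹ else 0) - 1 / (n : ℝ)| ≤ 4 * (r : ℝ) ^ 2 / n := by
  have hn : (0 : ℝ) < n := by exact_mod_cast (by omega : 0 < n)
  have hN : (0 : ℝ) < ((n - r : ℕ) : ℝ) := by exact_mod_cast (by omega : 0 < n - r)
  have hNr : ((n - r : ℕ) : ℝ) = n - r := Nat.cast_sub (by omega)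
  have hpt : ∀ a, |(if G a then ((n - r : ℕ) : ℝ)⁻¹ else 0) - 1 / (n : ℝ)|
      ≤ r / (n * ((n - r : ℕ) : ℝ)) + if ¬ G a then 1 / (n : ℝ) else 0 := by
    intro a
    by_cases h : G a
    · have e : ((n - r : ℕ) : ℝ)⁻¹ - 1 / (n : ℝ) = r / (n * ((n - r : ℕ) : ℝ)) := by
        field_simp
        rw [hNr]
        ring
      simp only [h, if_true, not_true_eq_false, if_false, add_zero]
      rw [e, abs_of_nonneg (by positivity)]
    · simp only [h, if_false, not_false_eq_true, if_true, zero_sub, abs_neg]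
      rw [abs_of_nonneg (by positivity)]
      exact le_add_of_nonneg_left (by positivity)
  refine (Finset.sum_le_sum fun a _ => hpt a).trans ?_
  rw [Finset.sum_add_distrib, ← Finset.sum_filter, Finset.sum_const, Finset.sum_const,
    nsmul_eq_mul, nsmul_eq_mul, Finset.card_univ]
  have h1 : (Fintype.card ι : ℝ) ≤ ((n - r : ℕ) : ℝ) * (2 * r) := by exact_mod_cast hcard
  have h2 : (({a | ¬ G a} : Finset ι).card : ℝ) ≤ r * (2 * r) := by exact_mod_cast hbad
  calc (Fintype.card ι : ℝ) * (r / (n * ((n - r : ℕ) : ℝ)))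
        + ({a | ¬ G a} : Finset ι).card * (1 / (n : ℝ))
      ≤ ((n - r : ℕ) : ℝ) * (2 * r) * (r / (n * ((n - r : ℕ) : ℝ)))
        + r * (2 * r) * (1 / (n : ℝ)) := by gcongr
    _ = 4 * (r : ℝ) ^ 2 / n := by
        field_simp
        ring

theorem mul_le_div_sq_of_le_inv {p N D C : ℝ} (hN : 0 < N) (hp : p ≤ N⁻¹) (hD : 0 ≤ D)
    (h : N * D ≤ C) : p * D ≤ C / N ^ 2 := by
  refine (mul_le_mul_of_nonneg_right hp hD).trans ?_
  rw [le_div_iff₀ (by positivity)]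
  refine le_of_eq_of_le ?_ h
  field_simp

theorem proposition3p2 (n r : ℕ) (hrn : r + 1 < n)
    (a : Fin r → Fin n) (ha : Function.Injective a)
    {Ω : Type*} [MeasurableSpace Ω] (μ : Measure Ω) [IsProbabilityMeasure μ]
    (π : Ω → Equiv.Perm (Fin n)) (hπ : HasLaw π (uniformOn Set.univ) μ)
    {Ω' : Type*} [MeasurableSpace Ω'] (ν : Measure Ω') [IsProbabilityMeasure ν]
    (Z : sepIndex n r → Ω' → ℕ)
    (hZ : ∀ p, HasLaw (Z p) (poissonMeasure (1 / (n : ℝ≥0))) ν)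
    (hZ_indep : iIndepFun Z ν) :
    tvDist
        ((cond μ {ω | ∀ j : Fin r, π ω (Fin.castLE (by omega) j) = a j}).map
          (fun ω => sepIndicators n r (π ω)))
        (ν.map (fun ω p => Z p ω))
      ≤ (16 * (r : ℝ) ^ 2 + 2 * (r : ℝ)) / ((n : ℝ) - (r : ℝ) - 1) := by
  -- The value outside the first `r` positions is an arbitrary default: `permsAgreeing P c` reads
  -- `c` only on `P`.
  let c : Fin n → Fin n := fun x => if h : (x : ℕ) < r then a ⟨x, h⟩ else x
  have hcx : ∀ (x : Fin n) (h : (x : ℕ) < r), c x = a ⟨x, h⟩ := fun x h => dif_pos h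
  have hc : Set.InjOn c (firstPositions n r) := fun x hx y hy hxy => by
    have hx' := mem_firstPositions.1 hx
    have hy' := mem_firstPositions.1 hy
    rw [hcx x hx', hcx y hy'] at hxy
    exact Fin.ext (Fin.mk.inj_iff.1 (ha hxy))
  set P := firstPositions n r with hPdef
  set S := permsAgreeing P c with hS
  have hSne : S.Nonempty := permsAgreeing_nonempty hc
  have hScard : (0 : ℝ) < S.card := by exact_mod_cast hSne.card_pos
  have hPcard : P.card = r := card_firstPositions (by omega)
  have himage : (P.image c).card = r := by rw [Finset.card_image_of_injOn hc, hPcard]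
  have hcompl : (P.image c)ᶜ.card = n - r := by
    rw [Finset.card_compl, himage, Fintype.card_fin]
  have hevent : {ω | ∀ j : Fin r, π ω (Fin.castLE (by omega) j) = a j} = π ⁻¹' S := by
    ext ω
    simp only [Set.mem_ofPred_eq, Set.mem_preimage, Finset.mem_coe, hS, mem_permsAgreeing]
    constructor
    · intro h x hx
      rw [hcx x (mem_firstPositions.1 hx)]
      exact h ⟨x, mem_firstPositions.1 hx⟩
    · intro h j
      have hj := h (Fin.castLE (by omega) j) (mem_firstPositions.2 j.2)
      rwa [hcx _ j.2] at hj
  have hN : (0 : ℝ) < ((n - r : ℕ) : ℝ) := by exact_mod_cast (by omega : 0 < n - r)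
  have hNr : ((n - r : ℕ) : ℝ) = n - r := Nat.cast_sub (by omega)
  let G : sepIndex n r → Prop := fun b => sepTarget b ∉ P.image c
  let p : sepIndex n r → ℝ := fun b => if G b then ((n - r : ℕ) : ℝ)⁻¹ else 0
  let τ : sepIndex n r → Equiv.Perm (Fin n) → Equiv.Perm (Fin n) := fun b π =>
    Equiv.swap (π b.1.1) (sepTarget b) * π
  have hp : ∀ b, 0 ≤ p b := fun b => by
    simp only [p]
    split_ifs <;> positivity
  have hτ : ∀ (M : Type) [AddCommGroup M] [Module ℝ M] (b : sepIndex n r)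
      (F : Equiv.Perm (Fin n) → M),
      ∑ x ∈ S with b ∈ sepSet r x, F x = p b • ∑ x ∈ S, F (τ b x) := by
    intro M _ _ b F
    simp only [mem_sepSet]
    by_cases hb : G b
    · rw [sum_permsAgreeing_swap_mul (position_notMem_firstPositions b) hb, hcompl,
        ← Nat.cast_smul_eq_nsmul ℝ, smul_smul]
      simp only [p, hb, if_true]
      rw [inv_mul_cancel₀ hN.ne', one_smul]
    · simp only [p, hb, if_false, zero_smul]
      rw [Finset.filter_eq_empty_iff.2 fun x hx (h : x b.1.1 = sepTarget b) =>
          hb (show sepTarget b ∉ P.image c from h ▸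
            apply_notMem_image_of_mem_permsAgreeing hx (position_notMem_firstPositions b)),
        Finset.sum_empty]
  rw [hevent]
  have htv := tvDist_poisson_le S hSne (sepSet r) hp τ hτ hZ hZ_indep
    (P := (cond μ (π ⁻¹' S)).map fun ω => sepIndicators n r (π ω)) fun A => by
      simp only [← sepIndicators_eq_sum_single]
      exact cond_map_real_of_hasLaw_uniformOn hπ S (sepIndicators n r) MeasurableSet.of_discrete
  have hcardle := card_sepIndex_le (n := n) (r := r) (by omega)
  have hbad : ({b | ¬ G b} : Finset (sepIndex n r)).card ≤ r * (2 * r) := by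
    simpa only [G, not_not, himage] using card_filter_sepTarget_mem_le (r := r) (P.image c)
  have h1 : ∑ b, |p b - ((1 / (n : ℝ≥0) : ℝ≥0) : ℝ)| ≤ 4 * (r : ℝ) ^ 2 / n := by
    simpa using sum_abs_sub_le_of_card G hrn hcardle hbad
  have h2 : (∑ b, p b * ∑ x ∈ S,
      ((symmDiff ((sepSet r (τ b x)).erase b) (sepSet r x)).card : ℝ)) / S.card
      ≤ 12 * (r : ℝ) ^ 2 / ((n - r : ℕ) : ℝ) := by
    have hb : ∀ b, p b * ∑ x ∈ S,
        ((symmDiff ((sepSet r (τ b x)).erase b) (sepSet r x)).card : ℝ)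
        ≤ 6 * r * S.card / ((n - r : ℕ) : ℝ) ^ 2 := by
      intro b
      have h : ((n - r : ℕ) : ℝ) * ∑ x ∈ S,
          ((symmDiff ((sepSet r (τ b x)).erase b) (sepSet r x)).card : ℝ) ≤ 6 * r * S.card := by
        exact_mod_cast sum_card_symmDiff_sepSet_le (c := c) hrn b
      have hpb : p b ≤ ((n - r : ℕ) : ℝ)⁻¹ := by
        simp only [p]
        split_ifs
        · exact le_rfl
        · positivity
      exact mul_le_div_sq_of_le_inv hN hpb (Finset.sum_nonneg fun _ _ => Nat.cast_nonneg _) h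
    rw [div_le_iff₀ hScard]
    refine (Finset.sum_le_card_nsmul _ _ _ fun b _ => hb b).trans ?_
    rw [nsmul_eq_mul, Finset.card_univ]
    have hle : (Fintype.card (sepIndex n r) : ℝ) ≤ ((n - r : ℕ) : ℝ) * (2 * r) := by
      exact_mod_cast hcardle
    refine (mul_le_mul_of_nonneg_right hle (by positivity)).trans_eq ?_
    field_simp
    ring
  have hn1 : (0 : ℝ) < n - r - 1 := by
    have : ((r + 1 : ℕ) : ℝ) < n := by exact_mod_cast hrn
    push_cast at this
    linarith
  have hr : (0 : ℝ) ≤ r := r.cast_nonneg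
  calc _ ≤ 4 * (r : ℝ) ^ 2 / n + 12 * (r : ℝ) ^ 2 / ((n - r : ℕ) : ℝ) :=
        htv.trans (add_le_add h1 h2)
    _ ≤ 4 * (r : ℝ) ^ 2 / (n - r - 1) + 12 * (r : ℝ) ^ 2 / (n - r - 1) := by
        rw [hNr]
        exact add_le_add (div_le_div_of_nonneg_left (by positivity) hn1 (by linarith))
          (div_le_div_of_nonneg_left (by positivity) hn1 (by linarith))
    _ = 16 * (r : ℝ) ^ 2 / (n - r - 1) := by ring
    -- The `2 * r` in the numerator is pure slack.
    _ ≤ _ := by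
        exact div_le_div_of_nonneg_right (by linarith) hn1.le
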